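/- Let $x_1,\dots,x_n$ be independent random vectors in $\mathbb{R}^d$, where $\{1,\dots,n\}$ is partitioned into clusters $\mathcal C_1,\dots,\mathcal C_K$ of sizes $n_1,\dots,n_K$ and $x_i\sim\mathcal N(\mu_k,\Sigma_k)$ whenever $i\in\mathcal C_k$, with $\mu_k\in\mathbb{R}^d$ and $\Sigma_k\in\mathbb{R}^{d\times d}$ symmetric positive semidefinite. Let $f:[0,+\infty)\to[0,1]$ be $\ell$-Lipschitz with $\ell>0$, and let $$A=\big(f(\|x_i-x_j\|_2)\big)_{1\le i,j\le n},\qquad \bar A=\big(\mathrm{E}\,f(\|x_i-x_j\|_2)\big)_{1\le i,j\le n}.$$ Let $\sigma\ge 0$ be given by $\sigma^2=\frac1n\sum_{k=1}^K n_k\,\rho(\Sigma_k)$, where $\rho(\Sigma_k)$ is the largest eigenvalue of $\Sigma_k$, and assume $\sigma>0$. For $M\in\mathbb{R}^{n\times n}$ write $\|M\|_{\infty\to1}=\sup_{\|u\|_\infty\le1}\|Mu\|_1$. Then, for every $t>2\sqrt{2\log 2}\,\ell\sigma$, $$\mathrm{P}\big(\|A-\bar A\|_{\infty\to1}>t\,n^2\big)\le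 2\exp\left(-\frac{\big(t-2\sqrt{2\log 2}\,\ell\sigma\big)^2}{32\,\ell^2\sigma^2}\,n\right).$$ -/

import Mathlib

open MeasureTheory ProbabilityTheory
open scoped NNReal Matrix

namespace GaussianCluster

variable {Ω : Type*} [MeasurableSpace Ω] {n K d : ℕ}

/-- The Gaussian cluster model: the population `{1, …, n}` is partitioned into `K` clusters by the
label map `k`, the observations `x i` are independent, and `x i` has law
`N(μ (k i), S (k i))`, where the `S j` are covariance (symmetric positive semidefinite) matrices. -/
structure IsModel (P : Measure Ω) (k : Fin n → Fin K) (μ : Fin K → EuclideanSpace ℝ (Fin d))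
    (S : Fin K → Matrix (Fin d) (Fin d) ℝ) (x : Fin n → Ω → EuclideanSpace ℝ (Fin d)) : Prop where
  posSemidef : ∀ j, (S j).PosSemidef
  hasLaw : ∀ i, HasLaw (x i) (multivariateGaussian (μ (k i)) (S (k i))) P
  indep : iIndepFun x P

/-- The size of the cluster with index `j`. -/
def clusterSize (k : Fin n → Fin K) (j : Fin K) : ℕ :=
  (Finset.univ.filter fun i => k i = j).card

/-- The largest eigenvalue of a symmetric real matrix. -/
noncomputable def largestEigenvalue (M : Matrix (Fin d) (Fin d) ℝ) : ℝ :=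
  sSup (spectrum ℝ M)

/-- `σ = √((1/n) ∑ⱼ nⱼ ρ(Sⱼ))`, with `nⱼ` the cluster sizes and `ρ` the largest eigenvalue. -/
noncomputable def sigma (k : Fin n → Fin K) (S : Fin K → Matrix (Fin d) (Fin d) ℝ) : ℝ :=
  Real.sqrt ((1 / (n : ℝ)) * ∑ j, (clusterSize k j : ℝ) * largestEigenvalue (S j))

/-- The affinity matrix `(f(‖xᵢ - xⱼ‖₂))ᵢⱼ`, for a given outcome `ω`. -/
noncomputable def affinity (f : ℝ≥0 → ℝ) (x : Fin n → Ω → EuclideanSpace ℝ (Fin d)) (ω : Ω) :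
    Matrix (Fin n) (Fin n) ℝ :=
  Matrix.of fun i j => f ‖x i ω - x j ω‖₊

/-- The expected affinity matrix `(E f(‖xᵢ - xⱼ‖₂))ᵢⱼ`. -/
noncomputable def expectedAffinity (P : Measure Ω) (f : ℝ≥0 → ℝ)
    (x : Fin n → Ω → EuclideanSpace ℝ (Fin d)) : Matrix (Fin n) (Fin n) ℝ :=
  Matrix.of fun i j => ∫ ω, affinity f x ω i j ∂P

/-- The `ℓ^∞ → ℓ^1` norm `sup {‖M u‖₁ : ‖u‖_∞ ≤ 1}`
(the norm of `Fin n → ℝ` is the sup norm). -/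
noncomputable def normInftyOne (M : Matrix (Fin n) (Fin n) ℝ) : ℝ :=
  sSup ((fun u : Fin n → ℝ => ∑ i, |(M *ᵥ u) i|) '' {u | ‖u‖ ≤ 1})

end GaussianCluster

/-! The norm of `A - Ā` is a Lipschitz function of independent Gaussian vectors, so it concentrates
around its mean, and the mean is bounded separately.

Concentration is the Maurey–Pisier argument (`integral_exp_mul_sub_prod_le`): a quarter turn in the
plane of two independent copies carries one to the other and preserves their joint law, which makes
an `L`-Lipschitz function sub-Gaussian with parameter `π² L² / 4`. Writing `x i` as `μ + √S z` turns
the weights `a i` into `L² = ∑ a i² ρ i`; for the norm, `a i = 2 n l` and the parameter is `π² n³ l²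
σ²`.

For the mean, the norm is at most the sum of the absolute entries. Each entry is sub-Gaussian, so
its mean absolute deviation is at most the square root of its parameter; Cauchy–Schwarz over the
`n²` entries gives `(π / √2) l σ n²`, below the threshold in the statement. The tail at the excess
`r n²` over this threshold then gives the exponent, as `2 π² ≤ 32`. -/

namespace MeasureTheory

/-- A finite product of absolutely continuous measures is absolutely continuous. -/
theorem Measure.AbsolutelyContinuous.pi_fin {X : Type*} [MeasurableSpace X] {p q : Measure X}
    [SigmaFinite p] [SigmaFinite q] (h : p ≪ q) (m : ℕ) :
    Measure.pi (fun _ : Fin m => p) ≪ Measure.pi (fun _ : Fin m => q) := by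
  induction m with
  | zero => rw [Measure.pi_of_empty (fun _ : Fin 0 => p), Measure.pi_of_empty (fun _ : Fin 0 => q)]
  | succ m ih =>
    have hp := (measurePreserving_piFinSuccAbove (fun _ : Fin (m + 1) => p) 0).symm
    have hq := (measurePreserving_piFinSuccAbove (fun _ : Fin (m + 1) => q) 0).symm
    rw [← hp.map_eq, ← hq.map_eq]
    exact (h.prod ih).map (MeasurableEquiv.measurable _)

end MeasureTheory

namespace ProbabilityTheory

/-! ### Maurey–Pisier concentration for the standard Gaussian measure. -/

section StdGaussian

variable {E : Type*} [NormedAddCommGroup E] [InnerProductSpace ℝ E] [FiniteDimensional ℝ E]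
  [MeasurableSpace E] [BorelSpace E]

/-- Transfers Rademacher's theorem from Lebesgue to Gaussian almost every point. -/
theorem stdGaussian_absolutelyContinuous : stdGaussian E ≪ volume := by
  have hpi : Measure.pi (fun _ : Fin (Module.finrank ℝ E) => gaussianReal 0 1) ≪ volume :=
    (gaussianReal_absolutelyContinuous 0 one_ne_zero).pi_fin _
  have hmp : MeasurePreserving
      (fun x : Fin (Module.finrank ℝ E) → ℝ => ∑ i, x i • stdOrthonormalBasis ℝ E i) := by
    have h := ((stdOrthonormalBasis ℝ E).repr.symm.measurePreserving).comp
      (PiLp.volume_preserving_toLp (Fin (Module.finrank ℝ E)))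
    convert h using 1
    ext x
    simp [OrthonormalBasis.sum_repr_symm]
  rw [stdGaussian, ← hmp.map_eq]
  exact hpi.map hmp.measurable

/-- Fernique's theorem, with `c‖x‖ ≤ c² / (4C) + C‖x‖²` from completing the square. Supplies the
dominating functions below. -/
theorem integrable_exp_mul_norm_stdGaussian (c : ℝ) :
    Integrable (fun x : E => Real.exp (c * ‖x‖)) (stdGaussian E) := by
  obtain ⟨C, hC, hint⟩ := IsGaussian.exists_integrable_exp_sq (stdGaussian E)
  refine (hint.const_mul (Real.exp (c ^ 2 / (4 * C)))).mono' (by fun_prop) (ae_of_all _ fun x => ?_)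
  rw [Real.norm_eq_abs, Real.abs_exp, ← Real.exp_add, Real.exp_le_exp]
  have h : c ^ 2 / (4 * C) + C * ‖x‖ ^ 2 - c * ‖x‖ = (c - 2 * C * ‖x‖) ^ 2 / (4 * C) := by
    field_simp
    ring
  have : 0 ≤ (c - 2 * C * ‖x‖) ^ 2 / (4 * C) := by positivity
  linarith

theorem integral_exp_strongDual_stdGaussian (φ : StrongDual ℝ E) :
    ∫ x, Real.exp (φ x) ∂(stdGaussian E) = Real.exp (‖φ‖ ^ 2 / 2) := by
  have h := mgf_gaussianReal (IsGaussian.map_eq_gaussianReal (μ := stdGaussian E) φ) 1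
  rw [integral_strongDual_stdGaussian, variance_dual_stdGaussian] at h
  simpa [mgf, Real.coe_toNNReal _ (sq_nonneg ‖φ‖)] using h

/-- The planar rotation of angle `θ` acting on pairs of independent standard Gaussian vectors. -/
theorem measurePreserving_rotation_stdGaussian (θ : ℝ) :
    MeasurePreserving (ContinuousLinearMap.rotation (E := E) θ)
      ((stdGaussian E).prod (stdGaussian E)) ((stdGaussian E).prod (stdGaussian E)) :=
  ⟨(ContinuousLinearMap.rotation θ).continuous.measurable,
    IsGaussian.map_rotation_eq_self (by simp) θ⟩

theorem rotation_rotation {E : Type*} [NormedAddCommGroup E] [NormedSpace ℝ E] (a b : ℝ)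
    (p : E × E) :
    ContinuousLinearMap.rotation a (ContinuousLinearMap.rotation b p) =
      ContinuousLinearMap.rotation (b + a) p := by
  simp only [ContinuousLinearMap.rotation_apply, Real.cos_add, Real.sin_add]
  ext
  · simp only
    module
  · simp only
    module

theorem norm_rotation_fst_sub_le {E : Type*} [NormedAddCommGroup E] [NormedSpace ℝ E] {δ : ℝ}
    (h0 : 0 ≤ δ) (h2 : δ ≤ 2) (p : E × E) :
    ‖(ContinuousLinearMap.rotation δ p).1 - p.1‖ ≤ δ * (‖p.1‖ + ‖p.2‖) := by
  have hc : |Real.cos δ - 1| ≤ δ := by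
    rw [abs_sub_comm, abs_of_nonneg (by linarith [Real.cos_le_one δ])]
    nlinarith [Real.one_sub_sq_div_two_le_cos (x := δ)]
  have hs : |Real.sin δ| ≤ δ := by
    simpa [abs_of_nonneg h0] using Real.abs_sin_le_abs (x := δ)
  have : (ContinuousLinearMap.rotation δ p).1 - p.1
      = (Real.cos δ - 1) • p.1 + Real.sin δ • p.2 := by
    rw [ContinuousLinearMap.rotation_apply]
    module
  rw [this, mul_add]
  refine (norm_add_le _ _).trans ?_
  rw [norm_smul, norm_smul, Real.norm_eq_abs, Real.norm_eq_abs]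
  gcongr

/-- Scaled increments of a Lipschitz function along a small rotation. -/
theorem abs_rotation_increment_le {E : Type*} [NormedAddCommGroup E] [NormedSpace ℝ E]
    {F : E → ℝ} {L : ℝ≥0} (hF : LipschitzWith L F) {N : ℕ} (hN : 1 ≤ N) (p : E × E) :
    |N * (F (ContinuousLinearMap.rotation (Real.pi / (2 * N)) p).1 - F p.1)| ≤
      L * (Real.pi / 2) * (‖p.1‖ + ‖p.2‖) := by
  have hN' : (1 : ℝ) ≤ N := by exact_mod_cast hN
  have hδ0 : 0 ≤ Real.pi / (2 * N) := by positivity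
  have hδ2 : Real.pi / (2 * N) ≤ 2 := by
    rw [div_le_iff₀ (by positivity)]
    nlinarith [Real.pi_le_four]
  have h1 := hF.dist_le_mul (ContinuousLinearMap.rotation (Real.pi / (2 * N)) p).1 p.1
  rw [Real.dist_eq, dist_eq_norm] at h1
  have h2 := norm_rotation_fst_sub_le hδ0 hδ2 p
  rw [abs_mul, Nat.abs_cast]
  calc (N : ℝ) * |F (ContinuousLinearMap.rotation (Real.pi / (2 * N)) p).1 - F p.1|
      ≤ N * (L * (Real.pi / (2 * N) * (‖p.1‖ + ‖p.2‖))) := by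
        gcongr
        exact h1.trans (by gcongr)
    _ = L * (Real.pi / 2) * (‖p.1‖ + ‖p.2‖) := by
        field_simp

/-- The curve `cos θ • x + sin θ • y` leaves `x` with velocity `y`; the factor `π / 2` is `N` times
the angle. -/
theorem tendsto_rotation_increment {E : Type*} [NormedAddCommGroup E] [NormedSpace ℝ E]
    {F : E → ℝ} {x : E} (hF : DifferentiableAt ℝ F x) (y : E) :
    Filter.Tendsto (fun N : ℕ => (N : ℝ) *
        (F (ContinuousLinearMap.rotation (Real.pi / (2 * N)) (x, y)).1 - F x))
      Filter.atTop (nhds (Real.pi / 2 * fderiv ℝ F x y)) := by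
  have hcurve : HasDerivAt (fun θ : ℝ => (ContinuousLinearMap.rotation θ (x, y)).1) y 0 := by
    simp only [ContinuousLinearMap.rotation_apply]
    have h := ((Real.hasDerivAt_cos 0).smul_const x).add ((Real.hasDerivAt_sin 0).smul_const y)
    simpa using! h
  have hx : (ContinuousLinearMap.rotation (0 : ℝ) (x, y)).1 = x := by
    simp [ContinuousLinearMap.rotation_apply]
  have hcomp : HasDerivAt (fun θ : ℝ => F (ContinuousLinearMap.rotation θ (x, y)).1)
      (fderiv ℝ F x y) 0 := by
    have hF' : HasFDerivAt F (fderiv ℝ F x) (ContinuousLinearMap.rotation (0 : ℝ) (x, y)).1 := by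
      rw [hx]
      exact hF.hasFDerivAt
    exact hF'.comp_hasDerivAt 0 hcurve
  have hslope := hasDerivAt_iff_tendsto_slope.1 hcomp
  have hseq : Filter.Tendsto (fun N : ℕ => Real.pi / (2 * (N : ℝ))) Filter.atTop
      (nhdsWithin 0 {0}ᶜ) := by
    refine tendsto_nhdsWithin_iff.2 ⟨?_, ?_⟩
    · have := (tendsto_const_div_atTop_nhds_zero_nat (Real.pi / 2))
      refine this.congr fun N => ?_
      rw [div_div]
    · filter_upwards [Filter.eventually_ge_atTop 1] with N hN
      have : (0 : ℝ) < N := by exact_mod_cast hN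
      have : Real.pi / (2 * N) ≠ 0 := by positivity
      simpa using this
  refine ((hslope.comp hseq).const_mul (Real.pi / 2)).congr' ?_
  filter_upwards [Filter.eventually_ge_atTop 1] with N hN
  have hN' : (0 : ℝ) < N := by exact_mod_cast hN
  have hpi := Real.pi_pos
  simp only [Function.comp_apply, slope_def_field, hx, sub_zero]
  field_simp

theorem integrable_exp_mul_norm_add_norm (c : ℝ) :
    Integrable (fun p : E × E => Real.exp (c * (‖p.1‖ + ‖p.2‖)))
      ((stdGaussian E).prod (stdGaussian E)) := by
  simp_rw [mul_add, Real.exp_add]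
  exact (integrable_exp_mul_norm_stdGaussian c).mul_prod (integrable_exp_mul_norm_stdGaussian c)

theorem integrable_exp_rotation_increment {F : E → ℝ} {L : ℝ≥0} (hF : LipschitzWith L F) (s : ℝ)
    {N : ℕ} (hN : 1 ≤ N) :
    Integrable (fun p : E × E => Real.exp (s * (N *
        (F (ContinuousLinearMap.rotation (Real.pi / (2 * N)) p).1 - F p.1))))
      ((stdGaussian E).prod (stdGaussian E)) := by
  have hFc := hF.continuous
  refine (integrable_exp_mul_norm_add_norm (|s| * (L * (Real.pi / 2)))).mono'
    (Continuous.aestronglyMeasurable (by fun_prop)) (ae_of_all _ fun p => ?_)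
  rw [Real.norm_eq_abs, Real.abs_exp, Real.exp_le_exp]
  refine (le_abs_self _).trans ?_
  rw [abs_mul, mul_assoc]
  gcongr
  exact abs_rotation_increment_le hF hN p

theorem integrable_exp_mul_sub_prod {F : E → ℝ} {L : ℝ≥0} (hF : LipschitzWith L F) (s : ℝ) :
    Integrable (fun p : E × E => Real.exp (s * (F p.2 - F p.1)))
      ((stdGaussian E).prod (stdGaussian E)) := by
  have hFc := hF.continuous
  refine (integrable_exp_mul_norm_add_norm (|s| * L)).mono'
    (Continuous.aestronglyMeasurable (by fun_prop)) (ae_of_all _ fun p => ?_)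
  rw [Real.norm_eq_abs, Real.abs_exp, Real.exp_le_exp]
  refine (le_abs_self _).trans ?_
  rw [abs_mul, mul_assoc]
  gcongr
  have h := hF.dist_le_mul p.2 p.1
  rw [Real.dist_eq, dist_eq_norm] at h
  refine h.trans ?_
  gcongr
  rw [add_comm]
  exact norm_sub_le _ _

/-- The increment of `F` over a quarter turn is controlled, in exponential moment, by its scaled
increment over a small rotation. -/
theorem integral_exp_sub_le_rotation_increment {F : E → ℝ} {L : ℝ≥0} (hF : LipschitzWith L F)
    (s : ℝ) {N : ℕ} (hN : 1 ≤ N) :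
    ∫ p : E × E, Real.exp (s * (F p.2 - F p.1)) ∂((stdGaussian E).prod (stdGaussian E)) ≤
      ∫ p : E × E, Real.exp (s * (N *
        (F (ContinuousLinearMap.rotation (Real.pi / (2 * N)) p).1 - F p.1)))
        ∂((stdGaussian E).prod (stdGaussian E)) := by
  set γ := (stdGaussian E).prod (stdGaussian E)
  set δ : ℝ := Real.pi / (2 * N) with hδ
  set H : E × E → ℝ := fun p =>
    Real.exp (s * (N * (F (ContinuousLinearMap.rotation δ p).1 - F p.1)))
  have hN' : (0 : ℝ) < N := by exact_mod_cast hN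
  have hHint : Integrable H γ := integrable_exp_rotation_increment hF s hN
  have hrot (k : ℕ) := measurePreserving_rotation_stdGaussian (E := E) (k * δ)
  have hcomp (k : ℕ) : Integrable (fun p => H (ContinuousLinearMap.rotation (k * δ) p)) γ :=
    (hrot k).integrable_comp_of_integrable hHint
  have hval (k : ℕ) : ∫ p, H (ContinuousLinearMap.rotation (k * δ) p) ∂γ = ∫ p, H p ∂γ := by
    have h := integral_map (μ := γ) (φ := ContinuousLinearMap.rotation (E := E) (k * δ)) (f := H)
      (hrot k).measurable.aemeasurable (by rw [(hrot k).map_eq]; exact hHint.1)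
    rw [← h, (hrot k).map_eq]
  -- The quarter turn is cut into `N` equal rotations. The increments telescope, and the factor `N`
  -- makes their sum an average, to which Jensen applies.
  have hpt (p : E × E) : Real.exp (s * (F p.2 - F p.1)) ≤
      ∑ k ∈ Finset.range N, (1 / (N : ℝ)) * H (ContinuousLinearMap.rotation (k * δ) p) := by
    have htel : F p.2 - F p.1 = ∑ k ∈ Finset.range N,
        (F (ContinuousLinearMap.rotation δ (ContinuousLinearMap.rotation (k * δ) p)).1 -
          F (ContinuousLinearMap.rotation (k * δ) p).1) := by
      have hstep (k : ℕ) : ContinuousLinearMap.rotation δ (ContinuousLinearMap.rotation (k * δ) p)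
          = ContinuousLinearMap.rotation ((k + 1 : ℕ) * δ) p := by
        rw [rotation_rotation]
        congr 2
        push_cast
        ring
      simp_rw [hstep]
      rw [Finset.sum_range_sub (fun k : ℕ => F (ContinuousLinearMap.rotation (k * δ) p).1)]
      have : (N : ℝ) * δ = Real.pi / 2 := by
        rw [hδ]
        field_simp
      rw [this]
      simp [ContinuousLinearMap.rotation_apply]
    have hJ := convexOn_exp.map_sum_le (t := Finset.range N) (w := fun _ => 1 / (N : ℝ))
      (p := fun k : ℕ => s * (N * (F (ContinuousLinearMap.rotation δ
        (ContinuousLinearMap.rotation (k * δ) p)).1 -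
          F (ContinuousLinearMap.rotation (k * δ) p).1)))
      (fun _ _ => by positivity) (by simp [hN'.ne']) (fun _ _ => Set.mem_univ _)
    simp only [smul_eq_mul] at hJ
    refine le_of_eq_of_le (congrArg Real.exp ?_) hJ
    rw [htel, Finset.mul_sum]
    refine Finset.sum_congr rfl fun k _ => ?_
    field_simp
  calc ∫ p : E × E, Real.exp (s * (F p.2 - F p.1)) ∂γ
      ≤ ∫ p, ∑ k ∈ Finset.range N,
          (1 / (N : ℝ)) * H (ContinuousLinearMap.rotation (k * δ) p) ∂γ :=
        integral_mono (integrable_exp_mul_sub_prod hF s)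
          (integrable_finsetSum _ fun k _ => (hcomp k).const_mul _) hpt
    _ = ∫ p, H p ∂γ := by
        rw [integral_finsetSum _ fun k _ => (hcomp k).const_mul _]
        simp_rw [integral_const_mul, hval]
        simp [hN'.ne']

/-- **Maurey–Pisier inequality** for the difference of two independent copies. -/
theorem integral_exp_mul_sub_prod_le {F : E → ℝ} {L : ℝ≥0} (hF : LipschitzWith L F) (s : ℝ) :
    ∫ p : E × E, Real.exp (s * (F p.2 - F p.1)) ∂((stdGaussian E).prod (stdGaussian E)) ≤
      Real.exp (Real.pi ^ 2 / 4 * L ^ 2 * s ^ 2 / 2) := by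
  have hFc := hF.continuous
  set γ := (stdGaussian E).prod (stdGaussian E)
  have hdiff : ∀ᵐ p : E × E ∂γ, DifferentiableAt ℝ F p.1 :=
    Measure.quasiMeasurePreserving_fst.ae
      (stdGaussian_absolutelyContinuous.ae_le hF.ae_differentiableAt)
  have hlim : ∀ᵐ p : E × E ∂γ, Filter.Tendsto (fun N : ℕ => Real.exp (s * (N *
        (F (ContinuousLinearMap.rotation (Real.pi / (2 * N)) p).1 - F p.1)))) Filter.atTop
      (nhds (Real.exp (s * (Real.pi / 2 * fderiv ℝ F p.1 p.2)))) := by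
    filter_upwards [hdiff] with p hp
    exact (Real.continuous_exp.tendsto _).comp ((tendsto_rotation_increment hp p.2).const_mul s)
  have hbound : ∀ᶠ N : ℕ in Filter.atTop, ∀ᵐ p : E × E ∂γ, ‖Real.exp (s * (N *
        (F (ContinuousLinearMap.rotation (Real.pi / (2 * N)) p).1 - F p.1)))‖ ≤
      Real.exp (|s| * (L * (Real.pi / 2)) * (‖p.1‖ + ‖p.2‖)) := by
    filter_upwards [Filter.eventually_ge_atTop 1] with N hN
    refine ae_of_all _ fun p => ?_
    rw [Real.norm_eq_abs, Real.abs_exp, Real.exp_le_exp]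
    refine (le_abs_self _).trans ?_
    rw [abs_mul, mul_assoc]
    gcongr
    exact abs_rotation_increment_le hF hN p
  have hmeas (N : ℕ) : AEStronglyMeasurable (fun p : E × E =>
      Real.exp (s * (N * (F (ContinuousLinearMap.rotation (Real.pi / (2 * N)) p).1 - F p.1)))) γ :=
    Continuous.aestronglyMeasurable (by fun_prop)
  have hdom := integrable_exp_mul_norm_add_norm (E := E) (|s| * (L * (Real.pi / 2)))
  have htend := tendsto_integral_filter_of_dominated_convergence _ (.of_forall hmeas) hbound
    hdom hlim
  have hle : ∫ p : E × E, Real.exp (s * (F p.2 - F p.1)) ∂γ ≤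
      ∫ p : E × E, Real.exp (s * (Real.pi / 2 * fderiv ℝ F p.1 p.2)) ∂γ := by
    refine ge_of_tendsto htend ?_
    filter_upwards [Filter.eventually_ge_atTop 1] with N hN
    exact integral_exp_sub_le_rotation_increment hF s hN
  -- Valid at every point: where `F` is not differentiable, `fderiv` is `0`.
  have hnorm (p : E × E) : |s * (Real.pi / 2 * fderiv ℝ F p.1 p.2)| ≤
      |s| * (L * (Real.pi / 2)) * (‖p.1‖ + ‖p.2‖) := by
    have h1 : |fderiv ℝ F p.1 p.2| ≤ L * ‖p.2‖ :=
      (ContinuousLinearMap.le_opNorm _ _).trans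
        (mul_le_mul_of_nonneg_right (norm_fderiv_le_of_lipschitz ℝ hF) (norm_nonneg _))
    rw [abs_mul, abs_mul, abs_of_pos (by positivity : 0 < Real.pi / 2)]
    calc |s| * (Real.pi / 2 * |fderiv ℝ F p.1 p.2|)
        ≤ |s| * (Real.pi / 2 * (L * (‖p.1‖ + ‖p.2‖))) := by
          gcongr
          refine h1.trans ?_
          gcongr
          linarith [norm_nonneg p.1]
      _ = _ := by ring
  have hint : Integrable (fun p : E × E => Real.exp (s * (Real.pi / 2 * fderiv ℝ F p.1 p.2))) γ := by
    refine hdom.mono' ?_ (ae_of_all _ fun p => ?_)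
    · exact aestronglyMeasurable_of_tendsto_ae Filter.atTop hmeas hlim
    · rw [Real.norm_eq_abs, Real.abs_exp, Real.exp_le_exp]
      exact (le_abs_self _).trans (hnorm p)
  refine hle.trans ?_
  rw [integral_prod _ hint]
  -- For fixed `x` the exponent is a linear form in `y`, whose Gaussian exponential moment is
  -- explicit.
  have hinner (x : E) : ∫ y, Real.exp (s * (Real.pi / 2 * fderiv ℝ F x y)) ∂(stdGaussian E) ≤
      Real.exp (Real.pi ^ 2 / 4 * L ^ 2 * s ^ 2 / 2) := by
    have h := integral_exp_strongDual_stdGaussian ((s * (Real.pi / 2)) • fderiv ℝ F x)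
    simp only [FunLike.coe_smul, Pi.smul_apply, smul_eq_mul, mul_assoc] at h
    rw [h, Real.exp_le_exp, norm_smul, mul_pow, Real.norm_eq_abs, sq_abs]
    have hn : ‖fderiv ℝ F x‖ ^ 2 ≤ (L : ℝ) ^ 2 := by
      gcongr
      exact norm_fderiv_le_of_lipschitz ℝ hF
    have := mul_le_mul_of_nonneg_left hn (sq_nonneg (s * (Real.pi / 2)))
    nlinarith
  calc ∫ x, ∫ y, Real.exp (s * (Real.pi / 2 * fderiv ℝ F x y)) ∂(stdGaussian E) ∂(stdGaussian E)
      ≤ ∫ _, Real.exp (Real.pi ^ 2 / 4 * L ^ 2 * s ^ 2 / 2) ∂(stdGaussian E) :=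
        integral_mono hint.integral_prod_left (integrable_const _) hinner
    _ = _ := by simp

theorem integrable_of_lipschitzWith_stdGaussian {F : E → ℝ} {L : ℝ≥0} (hF : LipschitzWith L F) :
    Integrable F (stdGaussian E) := by
  have hFc := hF.continuous
  have h : Integrable (fun x : E => |F 0| + L * ‖x‖) (stdGaussian E) :=
    (integrable_const _).add (IsGaussian.integrable_id.norm.const_mul _)
  refine h.mono' hFc.aestronglyMeasurable (ae_of_all _ fun x => ?_)
  have h1 := hF.dist_le_mul x 0
  rw [Real.dist_eq, dist_zero_right] at h1
  rw [Real.norm_eq_abs]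
  have := abs_sub_abs_le_abs_sub (F x) (F 0)
  linarith

/-- **Gaussian concentration**: a Lipschitz function of a standard Gaussian vector is
sub-Gaussian around its mean. -/
theorem hasSubgaussianMGF_of_lipschitzWith_stdGaussian {F : E → ℝ} {L : ℝ≥0}
    (hF : LipschitzWith L F) {c : ℝ≥0} (hc : Real.pi ^ 2 / 4 * L ^ 2 ≤ c) :
    HasSubgaussianMGF (fun x => F x - ∫ y, F y ∂(stdGaussian E)) c (stdGaussian E) := by
  have hFi := integrable_of_lipschitzWith_stdGaussian hF
  -- Jensen in `y` replaces the mean of `F` by an independent copy.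
  have hpt (s : ℝ) (x : E) (hx : Integrable (fun y => Real.exp (s * (F x - F y))) (stdGaussian E)) :
      Real.exp (s * (F x - ∫ y, F y ∂(stdGaussian E))) ≤
        ∫ y, Real.exp (s * (F x - F y)) ∂(stdGaussian E) := by
    have h := convexOn_exp.map_integral_le (μ := stdGaussian E) (f := fun y => s * (F x - F y))
      Real.continuous_exp.continuousOn isClosed_univ (ae_of_all _ fun _ => Set.mem_univ _)
      (((integrable_const _).sub hFi).const_mul s) hx
    rwa [integral_const_mul, integral_sub (integrable_const _) hFi, integral_const,
      probReal_univ, one_smul] at h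
  have hprod (s : ℝ) : Integrable (fun p : E × E => Real.exp (s * (F p.1 - F p.2)))
      ((stdGaussian E).prod (stdGaussian E)) := by
    have h := integrable_exp_mul_sub_prod hF (-s)
    refine h.congr (ae_of_all _ fun p => ?_)
    simp only
    congr 1
    ring
  have hint (s : ℝ) : Integrable (fun x => Real.exp (s * (F x - ∫ y, F y ∂(stdGaussian E))))
      (stdGaussian E) := by
    have hFc := hF.continuous
    refine (hprod s).integral_prod_left.mono'
      (Continuous.aestronglyMeasurable (by fun_prop)) ?_
    filter_upwards [(hprod s).prod_right_ae] with x hx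
    rw [Real.norm_eq_abs, Real.abs_exp]
    exact hpt s x hx
  refine ⟨hint, fun s => ?_⟩
  calc mgf (fun x => F x - ∫ y, F y ∂(stdGaussian E)) (stdGaussian E) s
      ≤ ∫ x, ∫ y, Real.exp (s * (F x - F y)) ∂(stdGaussian E) ∂(stdGaussian E) := by
        refine integral_mono_ae (hint s) (hprod s).integral_prod_left ?_
        filter_upwards [(hprod s).prod_right_ae] with x hx
        exact hpt s x hx
    _ = ∫ p : E × E, Real.exp (-s * (F p.2 - F p.1))
          ∂((stdGaussian E).prod (stdGaussian E)) := by
        rw [integral_integral (hprod s)]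
        congr with p
        congr 1
        ring
    _ ≤ Real.exp (Real.pi ^ 2 / 4 * L ^ 2 * (-s) ^ 2 / 2) := integral_exp_mul_sub_prod_le hF (-s)
    _ ≤ Real.exp (c * s ^ 2 / 2) := by
        rw [neg_sq]
        gcongr

end StdGaussian

/-! ### Moments of sub-Gaussian variables. -/

theorem _root_.Real.one_add_sq_div_two_le_cosh (x : ℝ) : 1 + x ^ 2 / 2 ≤ Real.cosh x := by
  have h : (x / 2) ^ 2 ≤ Real.sinh (x / 2) ^ 2 := by
    rw [sq_le_sq, Real.abs_sinh]
    exact Real.self_le_sinh_iff.2 (abs_nonneg _)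
  have h2 := Real.cosh_two_mul (x / 2)
  rw [Real.cosh_sq, mul_div_cancel₀ x two_ne_zero] at h2
  linarith

/-- The second moment of a sub-Gaussian variable is at most its parameter. -/
theorem HasSubgaussianMGF.integral_sq_le {Ω : Type*} [MeasurableSpace Ω] {P : Measure Ω}
    [IsProbabilityMeasure P] {X : Ω → ℝ} {c : ℝ≥0} (h : HasSubgaussianMGF X c P) :
    ∫ ω, X ω ^ 2 ∂P ≤ c := by
  have hsq : Integrable (fun ω => X ω ^ 2) P := (h.memLp 2).integrable_sq
  -- Integrates `2 + (sX)² ≤ 2 cosh (sX)`. Dividing by `u = s²` and letting `u → 0` then leaves the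
  -- derivative of `2 exp (c u / 2)` at `0`, which is `c`.
  have key (s : ℝ) (hs : 0 < s) : s ^ 2 * ∫ ω, X ω ^ 2 ∂P ≤ 2 * (Real.exp (c * s ^ 2 / 2) - 1) := by
    have hpt (ω : Ω) : 2 + s ^ 2 * X ω ^ 2 ≤ Real.exp (s * X ω) + Real.exp (-s * X ω) := by
      have h1 := Real.one_add_sq_div_two_le_cosh (s * X ω)
      rw [Real.cosh_eq] at h1
      rw [neg_mul]
      nlinarith
    have hi := integral_mono ((integrable_const (2 : ℝ)).add (hsq.const_mul (s ^ 2)))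
      ((h.integrable_exp_mul s).add (h.integrable_exp_mul (-s))) hpt
    have e1 : ∫ ω, (2 + s ^ 2 * X ω ^ 2) ∂P = 2 + s ^ 2 * ∫ ω, X ω ^ 2 ∂P := by
      rw [integral_add (integrable_const _) (hsq.const_mul _), integral_const_mul]
      simp
    have e2 : ∫ ω, (Real.exp (s * X ω) + Real.exp (-s * X ω)) ∂P
        = mgf X P s + mgf X P (-s) :=
      integral_add (h.integrable_exp_mul s) (h.integrable_exp_mul (-s))
    have m1 := h.mgf_le s
    have m2 := h.mgf_le (-s)
    rw [neg_sq] at m2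
    simp only [Pi.add_apply] at hi
    rw [e1, e2] at hi
    linarith
  have hlim : Filter.Tendsto (fun u : ℝ => 2 * (u⁻¹ * (Real.exp (c * u / 2) - 1)))
      (nhdsWithin 0 (Set.Ioi 0)) (nhds c) := by
    have hd : HasDerivAt (fun u : ℝ => Real.exp (c * u / 2)) (c / 2) 0 := by
      have h1 : HasDerivAt (fun u : ℝ => (c : ℝ) * u / 2) (c / 2) 0 := by
        simpa using! ((hasDerivAt_id (0 : ℝ)).const_mul (c : ℝ)).div_const 2
      simpa using! h1.exp
    have h2 := hd.tendsto_slope_zero_right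
    simp only [zero_add, mul_zero, zero_div, Real.exp_zero, smul_eq_mul] at h2
    convert h2.const_mul 2 using 2
    ring
  refine ge_of_tendsto hlim ?_
  filter_upwards [self_mem_nhdsWithin] with u hu
  have hu' : (0 : ℝ) < u := hu
  have h1 := key (Real.sqrt u) (Real.sqrt_pos.2 hu')
  rw [Real.sq_sqrt hu'.le] at h1
  have h2 : u⁻¹ * (u * ∫ ω, X ω ^ 2 ∂P) ≤ u⁻¹ * (2 * (Real.exp (c * u / 2) - 1)) := by gcongr
  rw [inv_mul_cancel_left₀ hu'.ne'] at h2
  linarith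

/-- The variance of `|X|` is nonnegative. -/
theorem HasSubgaussianMGF.integral_abs_le {Ω : Type*} [MeasurableSpace Ω] {P : Measure Ω}
    [IsProbabilityMeasure P] {X : Ω → ℝ} {c : ℝ≥0} (h : HasSubgaussianMGF X c P) :
    ∫ ω, |X ω| ∂P ≤ Real.sqrt c := by
  have hm : MemLp (fun ω => |X ω|) 2 P := (h.memLp 2).abs
  refine Real.le_sqrt_of_sq_le ?_
  have hv := variance_nonneg (fun ω => |X ω|) P
  rw [variance_eq_sub hm] at hv
  have := h.integral_sq_le
  simp only [Pi.pow_apply, sq_abs] at hv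
  linarith

end ProbabilityTheory

/-! ### Covariance matrices and independent Gaussian vectors. -/

namespace GaussianCluster

open scoped MatrixOrder

variable {d : ℕ}

theorem largestEigenvalue_nonneg {S : Matrix (Fin d) (Fin d) ℝ} (hS : S.PosSemidef) :
    0 ≤ largestEigenvalue S := by
  -- For `d = 0` the spectrum is empty and `sSup ∅ = 0`.
  refine Real.sSup_nonneg fun r hr => ?_
  rw [hS.isHermitian.spectrum_real_eq_range_eigenvalues] at hr
  obtain ⟨i, rfl⟩ := hr
  exact hS.eigenvalues_nonneg i

/-- The largest eigenvalue bounds the quadratic form. -/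
theorem dotProduct_mulVec_le_largestEigenvalue {S : Matrix (Fin d) (Fin d) ℝ}
    (hS : S.PosSemidef) (v : Fin d → ℝ) :
    v ⬝ᵥ S *ᵥ v ≤ largestEigenvalue S * (v ⬝ᵥ v) := by
  -- The spectrum of `ρ • 1 - S` is `ρ` minus that of `S`, hence nonnegative.
  have hpos : (algebraMap ℝ (Matrix (Fin d) (Fin d) ℝ) (largestEigenvalue S) - S).PosSemidef := by
    rw [Matrix.posSemidef_iff_isHermitian_and_spectrum_nonneg]
    refine ⟨?_, ?_⟩
    · refine Matrix.IsHermitian.sub ?_ hS.isHermitian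
      rw [Algebra.algebraMap_eq_smul_one]
      simp [Matrix.IsHermitian]
    · rw [← spectrum.singleton_sub_eq]
      rintro _ ⟨r, hr, s, hs, rfl⟩
      rw [Set.mem_singleton_iff] at hr
      subst hr
      have hbdd : BddAbove (spectrum ℝ S) := by
        rw [hS.isHermitian.spectrum_real_eq_range_eigenvalues]
        exact (Set.finite_range _).bddAbove
      exact sub_nonneg.2 (le_csSup hbdd hs)
  have h := hpos.dotProduct_mulVec_nonneg v
  rw [Matrix.sub_mulVec, Algebra.algebraMap_eq_smul_one, Matrix.smul_mulVec, Matrix.one_mulVec,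
    dotProduct_sub, dotProduct_smul, star_trivial, smul_eq_mul] at h
  linarith

theorem norm_toEuclideanCLM_sqrt_le {S : Matrix (Fin d) (Fin d) ℝ} (hS : S.PosSemidef)
    (v : EuclideanSpace ℝ (Fin d)) :
    ‖Matrix.toEuclideanCLM (𝕜 := ℝ) (CFC.sqrt S) v‖ ≤
      Real.sqrt (largestEigenvalue S) * ‖v‖ := by
  have hsa : IsSelfAdjoint (Matrix.toEuclideanCLM (𝕜 := ℝ) (CFC.sqrt S)) :=
    (CFC.sqrt_nonneg S).isSelfAdjoint.map _
  have hsq : ‖Matrix.toEuclideanCLM (𝕜 := ℝ) (CFC.sqrt S) v‖ ^ 2 = v.ofLp ⬝ᵥ S *ᵥ v.ofLp := by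
    rw [← real_inner_self_eq_norm_sq, ← ContinuousLinearMap.adjoint_inner_right,
      hsa.adjoint_eq, ← ContinuousLinearMap.comp_apply, ← ContinuousLinearMap.mul_def, ← map_mul,
      CFC.sqrt_mul_sqrt_self _ hS.nonneg, Matrix.inner_toEuclideanCLM]
  have hv : v.ofLp ⬝ᵥ v.ofLp = ‖v‖ ^ 2 := by
    rw [EuclideanSpace.real_norm_sq_eq]
    simp [dotProduct, sq]
  refine le_of_sq_le_sq ?_ (by positivity)
  rw [hsq, mul_pow, Real.sq_sqrt (largestEigenvalue_nonneg hS), ← hv]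
  exact dotProduct_mulVec_le_largestEigenvalue hS _

/-- A finite family of independent standard Gaussian vectors is a standard Gaussian vector. -/
theorem map_ofLp_stdGaussian (n d : ℕ) :
    (stdGaussian (PiLp 2 fun _ : Fin n => EuclideanSpace ℝ (Fin d))).map
        (WithLp.ofLp : _ → Fin n → EuclideanSpace ℝ (Fin d)) =
      Measure.pi fun _ : Fin n => stdGaussian (EuclideanSpace ℝ (Fin d)) := by
  have h : stdGaussian (PiLp 2 fun _ : Fin n => EuclideanSpace ℝ (Fin d)) =
      (Measure.pi fun _ : Fin n => stdGaussian (EuclideanSpace ℝ (Fin d))).map (WithLp.toLp 2) := by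
    apply Measure.ext_of_charFun
    ext s
    simp_rw [charFun_pi, charFun_stdGaussian, ← Complex.exp_sum]
    congr 1
    rw [← Complex.ofReal_pow, PiLp.norm_sq_eq_of_L2]
    push_cast
    rw [← Finset.sum_div, Finset.sum_neg_distrib]
  rw [h, Measure.map_map (by fun_prop) (by fun_prop)]
  exact Measure.map_id

/-- Concentration of a function of independent Gaussian vectors that is Lipschitz in each of
them. -/
theorem hasSubgaussianMGF_of_iIndepFun_multivariateGaussian
    {Ω : Type*} [MeasurableSpace Ω] {P : Measure Ω} [IsProbabilityMeasure P] {n : ℕ}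
    {m : Fin n → EuclideanSpace ℝ (Fin d)} {S : Fin n → Matrix (Fin d) (Fin d) ℝ}
    (hS : ∀ i, (S i).PosSemidef) {x : Fin n → Ω → EuclideanSpace ℝ (Fin d)}
    (hx : ∀ i, HasLaw (x i) (multivariateGaussian (m i) (S i)) P) (hind : iIndepFun x P)
    {G : (Fin n → EuclideanSpace ℝ (Fin d)) → ℝ} {a : Fin n → ℝ} (ha : ∀ i, 0 ≤ a i)
    (hG : ∀ y z, |G y - G z| ≤ ∑ i, a i * ‖y i - z i‖) {c : ℝ≥0}
    (hc : Real.pi ^ 2 / 4 * ∑ i, a i ^ 2 * largestEigenvalue (S i) ≤ c) :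
    HasSubgaussianMGF (fun ω => G (fun i => x i ω) - ∫ ω', G (fun i => x i ω') ∂P) c P := by
  -- `T` pushes one standard Gaussian vector to the joint law of the `x i`. Cauchy–Schwarz then
  -- gives the Lipschitz constant of `G ∘ T`.
  let T : (PiLp 2 fun _ : Fin n => EuclideanSpace ℝ (Fin d)) →
      Fin n → EuclideanSpace ℝ (Fin d) := fun z i =>
    m i + Matrix.toEuclideanCLM (𝕜 := ℝ) (CFC.sqrt (S i)) (z i)
  have hTc : Continuous T := by fun_prop
  have hGc : Continuous G := by
    refine continuous_iff_continuousAt.2 fun y => ?_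
    refine tendsto_iff_dist_tendsto_zero.2 ?_
    refine squeeze_zero (fun _ => dist_nonneg) (fun z => (Real.dist_eq _ _).trans_le (hG z y)) ?_
    have : Continuous fun z : Fin n → EuclideanSpace ℝ (Fin d) => ∑ i, a i * ‖z i - y i‖ := by
      fun_prop
    simpa using this.tendsto y
  have hlaw : IdentDistrib T (fun ω i => x i ω) (stdGaussian _) P := by
    refine ⟨hTc.aemeasurable, aemeasurable_pi_lambda _ fun i => (hx i).aemeasurable, ?_⟩
    rw [hind.map_fun_eq_pi_map fun i => (hx i).aemeasurable]
    simp_rw [fun i => (hx i).map_eq, multivariateGaussian]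
    rw [← Measure.pi_map_pi fun i => by fun_prop, ← map_ofLp_stdGaussian n d,
      Measure.map_map (by fun_prop) (by fun_prop)]
    rfl
  have hlawG := hlaw.comp hGc.measurable
  have hsum : 0 ≤ ∑ i, a i ^ 2 * largestEigenvalue (S i) :=
    Finset.sum_nonneg fun i _ => mul_nonneg (sq_nonneg _) (largestEigenvalue_nonneg (hS i))
  have hLip : LipschitzWith (Real.sqrt (∑ i, a i ^ 2 * largestEigenvalue (S i))).toNNReal
      (G ∘ T) := by
    refine LipschitzWith.of_dist_le_mul fun y z => ?_
    rw [Real.coe_toNNReal _ (Real.sqrt_nonneg _), Real.dist_eq, dist_eq_norm]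
    calc |G (T y) - G (T z)| ≤ ∑ i, a i * ‖T y i - T z i‖ := hG _ _
      _ ≤ ∑ i, (a i * Real.sqrt (largestEigenvalue (S i))) * ‖(y - z) i‖ := by
          refine Finset.sum_le_sum fun i _ => ?_
          rw [mul_assoc]
          refine mul_le_mul_of_nonneg_left ?_ (ha i)
          have : T y i - T z i =
              Matrix.toEuclideanCLM (𝕜 := ℝ) (CFC.sqrt (S i)) ((y - z) i) := by
            rw [PiLp.sub_apply, map_sub]
            exact add_sub_add_left_eq_sub _ _ _
          rw [this]
          exact norm_toEuclideanCLM_sqrt_le (hS i) _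
      _ ≤ Real.sqrt (∑ i, (a i * Real.sqrt (largestEigenvalue (S i))) ^ 2) *
            Real.sqrt (∑ i, ‖(y - z) i‖ ^ 2) := Real.sum_mul_le_sqrt_mul_sqrt _ _ _
      _ = _ := by
          rw [PiLp.norm_eq_of_L2]
          simp_rw [mul_pow, fun i => Real.sq_sqrt (largestEigenvalue_nonneg (hS i))]
  have h := hasSubgaussianMGF_of_lipschitzWith_stdGaussian hLip (c := c) (by
    rwa [Real.coe_toNNReal _ (Real.sqrt_nonneg _), Real.sq_sqrt hsum])
  rw [hlawG.integral_eq] at h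
  exact h.congr_identDistrib (hlawG.sub_const _)

/-! ### The `ℓ^∞ → ℓ^1` norm. -/

section NormInftyOne

variable {n : ℕ}

theorem sum_abs_mulVec_le (M : Matrix (Fin n) (Fin n) ℝ) {u : Fin n → ℝ} (hu : ‖u‖ ≤ 1) :
    ∑ i, |(M *ᵥ u) i| ≤ ∑ i, ∑ j, |M i j| := by
  refine Finset.sum_le_sum fun i _ => ?_
  rw [show (M *ᵥ u) i = ∑ j, M i j * u j from rfl]
  refine (Finset.abs_sum_le_sum_abs _ _).trans (Finset.sum_le_sum fun j _ => ?_)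
  rw [abs_mul]
  exact mul_le_of_le_one_right (abs_nonneg _) ((norm_le_pi_norm u j).trans hu)

theorem sum_abs_mulVec_le_normInftyOne (M : Matrix (Fin n) (Fin n) ℝ) {u : Fin n → ℝ}
    (hu : ‖u‖ ≤ 1) : ∑ i, |(M *ᵥ u) i| ≤ normInftyOne M := by
  refine le_csSup ⟨∑ i, ∑ j, |M i j|, ?_⟩ ⟨u, hu, rfl⟩
  rintro _ ⟨v, hv, rfl⟩
  exact sum_abs_mulVec_le M hv

theorem normInftyOne_le {M : Matrix (Fin n) (Fin n) ℝ} {b : ℝ}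
    (h : ∀ u : Fin n → ℝ, ‖u‖ ≤ 1 → ∑ i, |(M *ᵥ u) i| ≤ b) : normInftyOne M ≤ b := by
  refine csSup_le ⟨_, 0, by simp, rfl⟩ ?_
  rintro _ ⟨u, hu, rfl⟩
  exact h u hu

theorem normInftyOne_le_sum_abs (M : Matrix (Fin n) (Fin n) ℝ) :
    normInftyOne M ≤ ∑ i, ∑ j, |M i j| :=
  normInftyOne_le fun _ hu => sum_abs_mulVec_le M hu

theorem abs_normInftyOne_sub_le (M N : Matrix (Fin n) (Fin n) ℝ) :
    |normInftyOne M - normInftyOne N| ≤ ∑ i, ∑ j, |M i j - N i j| := by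
  have key (M N : Matrix (Fin n) (Fin n) ℝ) :
      normInftyOne M ≤ normInftyOne N + ∑ i, ∑ j, |M i j - N i j| := by
    refine normInftyOne_le fun u hu => ?_
    calc ∑ i, |(M *ᵥ u) i| ≤ ∑ i, (|(N *ᵥ u) i| + |((M - N) *ᵥ u) i|) := by
          refine Finset.sum_le_sum fun i _ => ?_
          rw [Matrix.sub_mulVec, Pi.sub_apply]
          have := abs_add_le ((N *ᵥ u) i) ((M *ᵥ u) i - (N *ᵥ u) i)
          rwa [add_sub_cancel] at this
      _ ≤ _ := by
          rw [Finset.sum_add_distrib]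
          exact add_le_add (sum_abs_mulVec_le_normInftyOne N hu) (sum_abs_mulVec_le (M - N) hu)
  rw [abs_sub_le_iff]
  have h1 := key M N
  have h2 := key N M
  simp_rw [fun i j => abs_sub_comm (N i j) (M i j)] at h2
  exact ⟨by linarith, by linarith⟩

end NormInftyOne

theorem abs_comp_nnnorm_sub_le {E : Type*} [NormedAddCommGroup E] {f : ℝ≥0 → ℝ} {l : ℝ≥0}
    (hf : LipschitzWith l f) (p q p' q' : E) :
    |f ‖p - q‖₊ - f ‖p' - q'‖₊| ≤ l * ‖p - p'‖ + l * ‖q - q'‖ := by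
  have h := hf.dist_le_mul ‖p - q‖₊ ‖p' - q'‖₊
  rw [Real.dist_eq, NNReal.dist_eq, coe_nnnorm, coe_nnnorm] at h
  refine h.trans ?_
  rw [← mul_add]
  gcongr
  refine (abs_norm_sub_norm_le _ _).trans ?_
  have : p - q - (p' - q') = (p - p') - (q - q') := by abel
  rw [this]
  exact norm_sub_le _ _

/-! ### Concentration and mean of the norm in the cluster model. -/

section Model

variable {Ω : Type*} [MeasurableSpace Ω] {P : Measure Ω} [IsProbabilityMeasure P] {n K : ℕ}
  {k : Fin n → Fin K} {μ : Fin K → EuclideanSpace ℝ (Fin d)}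
  {S : Fin K → Matrix (Fin d) (Fin d) ℝ} {x : Fin n → Ω → EuclideanSpace ℝ (Fin d)}
  {f : ℝ≥0 → ℝ} {l : ℝ≥0}

theorem sum_largestEigenvalue_eq (hS : ∀ j, (S j).PosSemidef) :
    ∑ i, largestEigenvalue (S (k i)) = n * sigma k S ^ 2 := by
  have hfib : ∑ i, largestEigenvalue (S (k i)) =
      ∑ j, (clusterSize k j : ℝ) * largestEigenvalue (S j) := by
    rw [← Finset.sum_fiberwise Finset.univ k]
    refine Finset.sum_congr rfl fun j _ => ?_
    rw [clusterSize, ← nsmul_eq_mul, ← Finset.sum_const]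
    refine Finset.sum_congr rfl fun i hi => ?_
    rw [(Finset.mem_filter.1 hi).2]
  have hnn : 0 ≤ ∑ j, (clusterSize k j : ℝ) * largestEigenvalue (S j) :=
    Finset.sum_nonneg fun j _ => mul_nonneg (Nat.cast_nonneg _) (largestEigenvalue_nonneg (hS j))
  rw [sigma, Real.sq_sqrt (by positivity), hfib]
  rcases Nat.eq_zero_or_pos n with rfl | hn
  · rw [← hfib]
    simp
  · field_simp

/-- Mean absolute deviation of a single affinity. -/
theorem integral_abs_affinity_sub_le (hx : IsModel P k μ S x) (hf : LipschitzWith l f)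
    (i j : Fin n) :
    Integrable (fun ω => affinity f x ω i j - expectedAffinity P f x i j) P ∧
    ∫ ω, |affinity f x ω i j - expectedAffinity P f x i j| ∂P ≤
      Real.sqrt (Real.pi ^ 2 / 4 * (l ^ 2 *
        (largestEigenvalue (S (k i)) + largestEigenvalue (S (k j))))) := by
  have hρ (i : Fin n) := largestEigenvalue_nonneg (hx.posSemidef (k i))
  set c : ℝ := Real.pi ^ 2 / 4 * (l ^ 2 *
    (largestEigenvalue (S (k i)) + largestEigenvalue (S (k j)))) with hc
  have hc0 : 0 ≤ c := mul_nonneg (by positivity) (mul_nonneg (by positivity)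
    (add_nonneg (hρ i) (hρ j)))
  have hsub : HasSubgaussianMGF
      (fun ω => affinity f x ω i j - expectedAffinity P f x i j) c.toNNReal P := by
    -- Diagonal entries are constant, so zero weights suffice. The generic weights would give
    -- `(2l)²` there, exceeding `c`; off the diagonal their squares have no cross term.
    rcases eq_or_ne i j with rfl | hij
    · refine hasSubgaussianMGF_of_iIndepFun_multivariateGaussian
        (G := fun y => f ‖y i - y i‖₊) (a := fun _ => 0) (fun _ => hx.posSemidef _) hx.hasLaw
        hx.indep (fun _ => le_rfl) (by simp) ?_
      simp [hc0]
    · refine hasSubgaussianMGF_of_iIndepFun_multivariateGaussian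
        (G := fun y => f ‖y i - y j‖₊)
        (a := fun r => (if r = i then (l : ℝ) else 0) + if r = j then (l : ℝ) else 0)
        (fun _ => hx.posSemidef _) hx.hasLaw hx.indep (fun r => by positivity) (fun y z => ?_) ?_
      · refine (abs_comp_nnnorm_sub_le hf (y i) (y j) (z i) (z j)).trans_eq ?_
        simp [add_mul, Finset.sum_add_distrib]
      · rw [Real.coe_toNNReal _ hc0, hc]
        gcongr
        have hsq (r : Fin n) : ((if r = i then (l : ℝ) else 0) + if r = j then (l : ℝ) else 0) ^ 2
            = (if r = i then (l : ℝ) ^ 2 else 0) + if r = j then (l : ℝ) ^ 2 else 0 := by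
          rcases eq_or_ne r i with rfl | h
          · simp [hij]
          · simp [h]
        simp_rw [hsq]
        simp [add_mul, Finset.sum_add_distrib, mul_add]
  refine ⟨hsub.integrable, ?_⟩
  have h := hsub.integral_abs_le
  rwa [Real.coe_toNNReal _ hc0] at h

/-- Moving `x i` affects only row and column `i`, at most `2 n` entries, each by at most `l` times
the displacement; hence the weight `2 n l`. -/
theorem hasSubgaussianMGF_normInftyOne (hx : IsModel P k μ S x) (hf : LipschitzWith l f) {c : ℝ≥0}
    (hc : Real.pi ^ 2 * n ^ 3 * l ^ 2 * sigma k S ^ 2 ≤ c) :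
    HasSubgaussianMGF (fun ω => normInftyOne (affinity f x ω - expectedAffinity P f x) -
      ∫ ω', normInftyOne (affinity f x ω' - expectedAffinity P f x) ∂P) c P := by
  refine hasSubgaussianMGF_of_iIndepFun_multivariateGaussian
    (G := fun y => normInftyOne
      ((Matrix.of fun i j => f ‖y i - y j‖₊) - expectedAffinity P f x))
    (a := fun _ => 2 * n * (l : ℝ)) (fun _ => hx.posSemidef _) hx.hasLaw hx.indep
    (fun _ => by positivity) (fun y z => ?_) ?_
  · refine (abs_normInftyOne_sub_le _ _).trans ?_
    calc _ ≤ ∑ i, ∑ j, ((l : ℝ) * ‖y i - z i‖ + l * ‖y j - z j‖) := by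
          refine Finset.sum_le_sum fun i _ => Finset.sum_le_sum fun j _ => ?_
          simp only [Matrix.sub_apply, Matrix.of_apply, sub_sub_sub_cancel_right]
          exact abs_comp_nnnorm_sub_le hf _ _ _ _
      _ = _ := by
          simp only [Finset.sum_add_distrib, Finset.sum_const, Finset.card_univ, Fintype.card_fin,
            nsmul_eq_mul, ← Finset.mul_sum]
          ring
  · rw [← Finset.mul_sum, sum_largestEigenvalue_eq hx.posSemidef]
    refine le_trans (le_of_eq ?_) hc
    ring

/-- Compares the constant of the mean bound with that of the threshold: `π² / 2 ≈ 4.93` and `8 log 2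
≈ 5.55`. -/
theorem pi_sq_div_two_le : Real.pi ^ 2 / 2 ≤ (2 * Real.sqrt (2 * Real.log 2)) ^ 2 := by
  have h1 := Real.pi_lt_d2
  have h2 := Real.log_two_gt_d9
  have h3 := Real.pi_pos
  rw [mul_pow, Real.sq_sqrt (by positivity)]
  nlinarith

theorem integral_normInftyOne_le (hx : IsModel P k μ S x) (hf : LipschitzWith l f) :
    ∫ ω, normInftyOne (affinity f x ω - expectedAffinity P f x) ∂P ≤
      2 * Real.sqrt (2 * Real.log 2) * l * sigma k S * n ^ 2 := by
  have hρ (i : Fin n) := largestEigenvalue_nonneg (hx.posSemidef (k i))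
  set w : Fin n → Fin n → ℝ := fun i j => Real.pi ^ 2 / 4 * (l ^ 2 *
    (largestEigenvalue (S (k i)) + largestEigenvalue (S (k j)))) with hw
  have hw0 (i j : Fin n) : 0 ≤ w i j := mul_nonneg (by positivity) (mul_nonneg (by positivity)
    (add_nonneg (hρ i) (hρ j)))
  have hdev (i j : Fin n) := integral_abs_affinity_sub_le hx hf i j
  have hint : Integrable (fun ω => ∑ i, ∑ j,
      |affinity f x ω i j - expectedAffinity P f x i j|) P :=
    integrable_finsetSum _ fun i _ => integrable_finsetSum _ fun j _ => (hdev i j).1.abs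
  have hstep : ∫ ω, normInftyOne (affinity f x ω - expectedAffinity P f x) ∂P ≤
      ∑ i, ∑ j, Real.sqrt (w i j) := by
    calc _ ≤ ∫ ω, ∑ i, ∑ j, |affinity f x ω i j - expectedAffinity P f x i j| ∂P := by
          refine integral_mono_of_nonneg (ae_of_all _ fun ω => ?_) hint
            (ae_of_all _ fun ω => normInftyOne_le_sum_abs _)
          refine le_trans ?_ (sum_abs_mulVec_le_normInftyOne _ (u := 0) (by simp))
          simp
      _ = ∑ i, ∑ j, ∫ ω, |affinity f x ω i j - expectedAffinity P f x i j| ∂P := by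
          rw [integral_finsetSum _ fun i _ => integrable_finsetSum _ fun j _ => (hdev i j).1.abs]
          refine Finset.sum_congr rfl fun i _ => ?_
          rw [integral_finsetSum _ fun j _ => (hdev i j).1.abs]
      _ ≤ _ := Finset.sum_le_sum fun i _ => Finset.sum_le_sum fun j _ => (hdev i j).2
  refine hstep.trans ?_
  have hσ0 : 0 ≤ sigma k S := Real.sqrt_nonneg _
  refine le_of_sq_le_sq ?_ (by positivity)
  have hsum : ∑ i, ∑ j, w i j = Real.pi ^ 2 / 2 * (n ^ 2 * l ^ 2 * sigma k S ^ 2) := by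
    simp only [hw, ← Finset.mul_sum, Finset.sum_add_distrib, Finset.sum_const, Finset.card_univ,
      Fintype.card_fin, nsmul_eq_mul, sum_largestEigenvalue_eq (k := k) hx.posSemidef]
    ring
  calc (∑ i, ∑ j, Real.sqrt (w i j)) ^ 2
      = (∑ p : Fin n × Fin n, Real.sqrt (w p.1 p.2)) ^ 2 := by rw [Fintype.sum_prod_type]
    _ ≤ Fintype.card (Fin n × Fin n) * ∑ p : Fin n × Fin n, Real.sqrt (w p.1 p.2) ^ 2 :=
        sq_sum_le_card_mul_sum_sq
    _ = n ^ 2 * ∑ i, ∑ j, w i j := by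
        rw [Fintype.sum_prod_type]
        simp_rw [fun i j => Real.sq_sqrt (hw0 i j)]
        simp [sq]
    _ ≤ (2 * Real.sqrt (2 * Real.log 2)) ^ 2 * (n ^ 4 * l ^ 2 * sigma k S ^ 2) := by
        rw [hsum]
        calc (n : ℝ) ^ 2 * (Real.pi ^ 2 / 2 * (n ^ 2 * l ^ 2 * sigma k S ^ 2))
            = Real.pi ^ 2 / 2 * (n ^ 4 * l ^ 2 * sigma k S ^ 2) := by ring
          _ ≤ _ := mul_le_mul_of_nonneg_right pi_sq_div_two_le (by positivity)
    _ = _ := by ring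

end Model

end GaussianCluster

theorem proposition1 {Ω : Type*} [MeasurableSpace Ω] (P : Measure Ω) [IsProbabilityMeasure P]
    {n K d : ℕ} (k : Fin n → Fin K) (μ : Fin K → EuclideanSpace ℝ (Fin d))
    (S : Fin K → Matrix (Fin d) (Fin d) ℝ) (x : Fin n → Ω → EuclideanSpace ℝ (Fin d))
    (hx : GaussianCluster.IsModel P k μ S x)
    (f : ℝ≥0 → ℝ) (hf01 : ∀ h, f h ∈ Set.Icc (0 : ℝ) 1)
    (l : ℝ≥0) (hf : LipschitzWith l f)
    (hl : 0 < l) (hσ : 0 < GaussianCluster.sigma k S)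
    (t : ℝ) (ht : 2 * Real.sqrt (2 * Real.log 2) * l * GaussianCluster.sigma k S < t) :
    P.real {ω | t * (n : ℝ) ^ 2 <
        GaussianCluster.normInftyOne
          (GaussianCluster.affinity f x ω - GaussianCluster.expectedAffinity P f x)} ≤
      2 * Real.exp
        (-((t - 2 * Real.sqrt (2 * Real.log 2) * l * GaussianCluster.sigma k S) ^ 2
            / (32 * (l : ℝ) ^ 2 * GaussianCluster.sigma k S ^ 2) * n)) := by
  -- For `n = 0`, `1 / n = 0` in Lean and `σ` would vanish.
  have hn : (0 : ℝ) < n := by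
    rcases Nat.eq_zero_or_pos n with rfl | hn
    · simp [GaussianCluster.sigma] at hσ
    · exact_mod_cast hn
  have hl' : (0 : ℝ) < l := hl
  have hmean := GaussianCluster.integral_normInftyOne_le hx hf
  set σ := GaussianCluster.sigma k S
  set r := t - 2 * Real.sqrt (2 * Real.log 2) * l * σ with hr
  have hr0 : 0 ≤ r := by linarith
  have hv0 : 0 ≤ Real.pi ^ 2 * n ^ 3 * l ^ 2 * σ ^ 2 := by positivity
  have hsub := GaussianCluster.hasSubgaussianMGF_normInftyOne hx hf
    (Real.coe_toNNReal _ hv0).ge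
  have htail := hsub.measure_ge_le (mul_nonneg hr0 (sq_nonneg (n : ℝ)))
  rw [Real.coe_toNNReal _ hv0] at htail
  have hpi : Real.pi ^ 2 ≤ 16 := by nlinarith [Real.pi_le_four, Real.pi_pos]
  calc _ ≤ _ := measureReal_mono fun ω hω => ?_
    _ ≤ _ := htail
    _ ≤ Real.exp (-(r ^ 2 / (32 * l ^ 2 * σ ^ 2) * n)) := by
        rw [Real.exp_le_exp, neg_div, neg_le_neg_iff, div_mul_eq_mul_div,
          div_le_div_iff₀ (by positivity) (by positivity)]
        have := mul_le_mul_of_nonneg_right hpi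
          (by positivity : 0 ≤ 2 * r ^ 2 * n ^ 4 * l ^ 2 * σ ^ 2)
        nlinarith
    -- The norm needs only an upper tail, so the factor `2` is slack.
    _ ≤ _ := le_mul_of_one_le_left (Real.exp_pos _).le one_le_two
  simp only [Set.mem_ofPred_eq] at hω ⊢
  have : r * (n : ℝ) ^ 2 = t * n ^ 2 - 2 * Real.sqrt (2 * Real.log 2) * l * σ * n ^ 2 := by
    rw [hr]
    ring
  linarith
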